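/- Let $p$ be a prime, $S$ a finite $p$-group and $\mathcal F$ a saturated fusion system on $S$. View $(S,S)$-bisets as left $S\times S$-sets via $(a,b)\cdot x = a x b^{-1}$, and let $\mathbb Z_{(p)}B(S,S)=\mathbb Z_{(p)}\otimes_{\mathbb Z}B(S\times S)$ be the double Burnside ring with coefficients in $\mathbb Z_{(p)}$, whose elements are called virtual $(S,S)$-bisets and whose product is the bilinear extension of $[X]\circ[Y]=[X\times_S Y]$. A virtual biset $\omega$ is $\mathcal F$-stable if, for all $P,Q\le S$ and all morphisms $\varphi\colon P\to S$ and $\psi\colon Q\to S$ of $\mathcal F$, the restrictions of $\omega$ to $P\times Q$ along $\varphi\times\psi$ and along the inclusion $P\times Q\hookrightarrow S\times S$ coincide; it is $\mathcal F$-generated if it is a $\mathbb Z_{(p)}$-linear combination of classes $[(S\times S)/\Delta(P,\varphi)]$, where $P\le S$, $\varphi\colon P\to S$ is a morphism of $\mathcal F$ and $\Delta(P,\varphi)=\{(u,\varphi(u))\mid u\in P\}$. Let $\omega_{\mathcal F}$ be the characteristic idempotent of $\mathcal F$, i.e. the unique nonzero element of $\mathbb Z_{(p)}B(S,S)$ which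 is $\mathcal F$-stable, $\mathcal F$-generated and idempotent. For $P,Q\le S$ let $|P\backslash\omega_{\mathcal F}/Q|\in\mathbb Z_{(p)}\subset\mathbb Q$ be the value at $\omega_{\mathcal F}$ of the $\mathbb Z_{(p)}$-linear extension of the map sending $[X]$ to the number $|P\backslash X/Q|$ of $(P,Q)$-orbits of $X$. Then the rank over $\mathbb Q$ of the matrix $$\bigl(|P\backslash\omega_{\mathcal F}/Q|\bigr)_{P,Q},$$ with rows and columns indexed by representatives $P$ and $Q$ of the $\mathcal F$-conjugacy classes of subgroups of $S$, equals the number of $\mathcal F$-conjugacy classes of cyclic subgroups of $S$. -/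

import Mathlib

open scoped TensorProduct

universe u

/-! ### Finite `G`-sets and their isomorphism classes -/

/-- A finite (left) `G`-set. -/
structure FinGSet (G : Type u) [Group G] : Type (u + 1) where
  carrier : Type u
  [action : MulAction G carrier]
  [fin : Finite carrier]

namespace FinGSet

variable {G : Type u} [Group G]

attribute [instance] FinGSet.action FinGSet.fin

/-- Two finite `G`-sets are isomorphic if there is a `G`-equivariant bijection between them. -/
def Iso (X Y : FinGSet G) : Prop :=
  ∃ e : X.carrier ≃ Y.carrier, ∀ (g : G) (x : X.carrier), e (g • x) = g • e x

theorem Iso.refl (X : FinGSet G) : X.Iso X := ⟨Equiv.refl _, fun _ _ => rfl⟩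

theorem Iso.symm {X Y : FinGSet G} : X.Iso Y → Y.Iso X := by
  rintro ⟨e, he⟩
  refine ⟨e.symm, fun g y => ?_⟩
  rw [Equiv.symm_apply_eq, he, Equiv.apply_symm_apply]

theorem Iso.trans {X Y Z : FinGSet G} : X.Iso Y → Y.Iso Z → X.Iso Z := by
  rintro ⟨e, he⟩ ⟨f, hf⟩
  exact ⟨e.trans f, fun g x => by simp [he, hf]⟩

instance isoSetoid (G : Type u) [Group G] : Setoid (FinGSet G) where
  r := Iso
  iseqv := ⟨Iso.refl, Iso.symm, Iso.trans⟩

/-- The empty `G`-set. -/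
def empty (G : Type u) [Group G] : FinGSet G where
  carrier := PEmpty
  action := { smul := fun _ x => x, one_smul := fun x => x.elim, mul_smul := fun _ _ x => x.elim }

/-- The disjoint union of two finite `G`-sets. -/
def sum (X Y : FinGSet G) : FinGSet G where
  carrier := X.carrier ⊕ Y.carrier

/-- The transitive `G`-set `G/K` of left cosets. -/
def cosets [Finite G] (K : Subgroup G) : FinGSet G where
  carrier := G ⧸ K

/-- The restriction of a finite `G`-set along a group homomorphism `f : H → G`:
the same set, on which `h` acts as `f h`. -/
def restrict {H : Type u} [Group H] (f : H →* G) (X : FinGSet G) : FinGSet H where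
  carrier := X.carrier
  action := MulAction.compHom X.carrier f

/-- The set of orbits of a finite `G`-set. -/
abbrev Orbits (X : FinGSet G) : Type u := MulAction.orbitRel.Quotient G X.carrier

theorem sum_congr {X X' Y Y' : FinGSet G} :
    X.Iso X' → Y.Iso Y' → (X.sum Y).Iso (X'.sum Y') := by
  rintro ⟨e, he⟩ ⟨f, hf⟩
  refine ⟨Equiv.sumCongr e f, ?_⟩
  rintro g (x | y)
  · exact congrArg Sum.inl (he g x)
  · exact congrArg Sum.inr (hf g y)

theorem restrict_congr {H : Type u} [Group H] (f : H →* G) {X Y : FinGSet G} :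
    X.Iso Y → (X.restrict f).Iso (Y.restrict f) := by
  rintro ⟨e, he⟩
  exact ⟨e, fun h x => he (f h) x⟩

theorem card_orbits_congr {X Y : FinGSet G} : X.Iso Y → Nat.card X.Orbits = Nat.card Y.Orbits := by
  rintro ⟨e, he⟩
  refine Nat.card_congr (Quotient.congr e fun a b => ?_)
  change a ∈ MulAction.orbit G b ↔ e a ∈ MulAction.orbit G (e b)
  constructor
  · rintro ⟨g, hg⟩
    exact ⟨g, by rw [← hg]; exact (he g b).symm⟩
  · rintro ⟨g, hg⟩
    exact ⟨g, e.injective (by rw [← hg]; exact he g b)⟩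

theorem card_orbits_sum (X Y : FinGSet G) :
    Nat.card (X.sum Y).Orbits = Nat.card X.Orbits + Nat.card Y.Orbits := by
  rw [← Nat.card_sum]
  refine Nat.card_congr
    { toFun := Quotient.lift (s := MulAction.orbitRel G (X.carrier ⊕ Y.carrier))
        (fun z => Sum.map (Quotient.mk (MulAction.orbitRel G X.carrier))
          (Quotient.mk (MulAction.orbitRel G Y.carrier)) z) ?_
      invFun := Sum.elim
        (Quotient.map' (s₁ := MulAction.orbitRel G X.carrier)
          (s₂ := MulAction.orbitRel G (X.carrier ⊕ Y.carrier)) Sum.inl ?_)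
        (Quotient.map' (s₁ := MulAction.orbitRel G Y.carrier)
          (s₂ := MulAction.orbitRel G (X.carrier ⊕ Y.carrier)) Sum.inr ?_)
      left_inv := ?_
      right_inv := ?_ }
  · rintro a b ⟨g, rfl⟩
    rcases b with b | b
    · exact congrArg Sum.inl (Quotient.sound (s := MulAction.orbitRel G X.carrier) ⟨g, rfl⟩)
    · exact congrArg Sum.inr (Quotient.sound (s := MulAction.orbitRel G Y.carrier) ⟨g, rfl⟩)
  · rintro a b ⟨g, rfl⟩
    exact ⟨g, rfl⟩
  · rintro a b ⟨g, rfl⟩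
    exact ⟨g, rfl⟩
  · intro z
    induction z using Quotient.inductionOn' with
    | h z => rcases z with z | z <;> rfl
  · rintro (z | z) <;> induction z using Quotient.inductionOn' <;> rfl

end FinGSet

/-- Isomorphism classes of finite `G`-sets. -/
def GSetClass (G : Type u) [Group G] : Type (u + 1) := Quotient (FinGSet.isoSetoid G)

namespace GSetClass

variable {G : Type u} [Group G]

/-- The isomorphism class of a finite `G`-set. -/
def mk (X : FinGSet G) : GSetClass G := Quotient.mk _ X

instance : Zero (GSetClass G) := ⟨mk (FinGSet.empty G)⟩

instance : Add (GSetClass G) :=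
  ⟨Quotient.map₂ FinGSet.sum fun _ _ h _ _ h' => FinGSet.sum_congr h h'⟩

/-- Isomorphism classes of finite `G`-sets form a commutative monoid under disjoint union. -/
instance : AddCommMonoid (GSetClass G) where
  add_assoc := by
    rintro ⟨X⟩ ⟨Y⟩ ⟨Z⟩
    refine Quotient.sound ⟨Equiv.sumAssoc _ _ _, ?_⟩
    rintro g ((x | y) | z) <;> rfl
  zero_add := by
    rintro ⟨X⟩
    refine Quotient.sound ⟨Equiv.emptySum PEmpty _, ?_⟩
    rintro g (x | y)
    · exact x.elim
    · rfl
  add_zero := by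
    rintro ⟨X⟩
    refine Quotient.sound ⟨Equiv.sumEmpty _ PEmpty, ?_⟩
    rintro g (x | y)
    · rfl
    · exact y.elim
  add_comm := by
    rintro ⟨X⟩ ⟨Y⟩
    refine Quotient.sound ⟨Equiv.sumComm _ _, ?_⟩
    rintro g (x | y) <;> rfl
  nsmul := nsmulRec

/-- Restriction along a homomorphism, on isomorphism classes. -/
def restrict {H : Type u} [Group H] (f : H →* G) : GSetClass G →+ GSetClass H where
  toFun := Quotient.map (FinGSet.restrict f) fun _ _ h => FinGSet.restrict_congr f h
  map_zero' := Quotient.sound ⟨Equiv.refl _, fun _ x => x.elim⟩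
  map_add' := by
    rintro ⟨X⟩ ⟨Y⟩
    refine Quotient.sound ⟨Equiv.refl _, ?_⟩
    rintro h (x | y) <;> rfl

/-- The number of orbits, on isomorphism classes. -/
noncomputable def orbitCount : GSetClass G →+ ℤ where
  toFun := Quotient.lift (fun X : FinGSet G => (Nat.card X.Orbits : ℤ))
    fun _ _ h => congrArg Nat.cast (FinGSet.card_orbits_congr h)
  map_zero' := by
    change ((Nat.card (FinGSet.empty G).Orbits : ℕ) : ℤ) = 0
    have : IsEmpty (FinGSet.empty G).Orbits := ⟨fun z => Quotient.inductionOn' z fun x => x.elim⟩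
    simp
  map_add' := by
    rintro ⟨X⟩ ⟨Y⟩
    change ((Nat.card (X.sum Y).Orbits : ℕ) : ℤ) = Nat.card X.Orbits + Nat.card Y.Orbits
    rw [FinGSet.card_orbits_sum, Nat.cast_add]

end GSetClass

/-! ### Composition of bisets

An `(S,S)`-biset `X` is a left `S × S`-set by inverting the right action: `(a, b) • x = a x b⁻¹`.
In particular `x s⁻¹ = (1, s) • x` and `s y = (s, 1) • y`. -/

namespace FinGSet

variable {S : Type u} [Group S]

/-- The equivalence relation on `X × Y` whose quotient is `X ×_S Y`:
`(x, y)` is equivalent to `(x s⁻¹, s y)` for all `s : S`. -/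
def balancedSetoid (X Y : FinGSet (S × S)) : Setoid (X.carrier × Y.carrier) where
  r a b := ∃ s : S, b.1 = ((1, s) : S × S) • a.1 ∧ b.2 = ((s, 1) : S × S) • a.2
  iseqv := by
    refine ⟨fun a => ⟨1, ?_, ?_⟩, ?_, ?_⟩
    · exact (one_smul (S × S) a.1).symm
    · exact (one_smul (S × S) a.2).symm
    · rintro a b ⟨s, h1, h2⟩
      refine ⟨s⁻¹, ?_, ?_⟩
      · rw [h1, smul_smul]; simp [← Prod.one_eq_mk]
      · rw [h2, smul_smul]; simp [← Prod.one_eq_mk]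
    · rintro a b c ⟨s, h1, h2⟩ ⟨t, h3, h4⟩
      refine ⟨t * s, ?_, ?_⟩
      · rw [h3, h1, smul_smul]; simp
      · rw [h4, h2, smul_smul]; simp

/-- The composite `X ∘ Y = X ×_S Y` of two `(S,S)`-bisets: the quotient of `X × Y` by the relation
`(x s, y) ∼ (x, s y)`, with `(a, b) • [x, y] = [a x, y b⁻¹]`. -/
def comp (X Y : FinGSet (S × S)) : FinGSet (S × S) where
  carrier := Quotient (balancedSetoid X Y)
  action :=
    { smul := fun g => Quotient.map
        (fun z => (((g.1, 1) : S × S) • z.1, ((1, g.2) : S × S) • z.2)) (by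
          rintro a b ⟨s, h1, h2⟩
          refine ⟨s, ?_, ?_⟩
          · simp only [h1, smul_smul]; simp
          · simp only [h2, smul_smul]; simp)
      one_smul := by
        rintro ⟨x, y⟩
        exact congrArg (Quotient.mk _) (Prod.ext (one_smul (S × S) x) (one_smul (S × S) y))
      mul_smul := by
        rintro g h ⟨x, y⟩
        refine congrArg (Quotient.mk _) (Prod.ext ?_ ?_)
        · simp only [smul_smul]; simp
        · simp only [smul_smul]; simp }

theorem comp_congr {X X' Y Y' : FinGSet (S × S)} :
    X.Iso X' → Y.Iso Y' → (X.comp Y).Iso (X'.comp Y') := by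
  rintro ⟨e, he⟩ ⟨f, hf⟩
  refine ⟨Quotient.congr (Equiv.prodCongr e f) ?_, ?_⟩
  · rintro ⟨x, y⟩ ⟨x', y'⟩
    change (∃ s : S, x' = _ ∧ y' = _) ↔ (∃ s : S, e x' = _ • e x ∧ f y' = _ • f y)
    simp only [← he, ← hf, e.injective.eq_iff, f.injective.eq_iff]
  · rintro g ⟨x, y⟩
    exact congrArg (Quotient.mk _) (Prod.ext (he _ x) (hf _ y))

theorem sum_comp (X X' Y : FinGSet (S × S)) :
    ((X.sum X').comp Y).Iso ((X.comp Y).sum (X'.comp Y)) := by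
  refine ⟨⟨Quotient.lift
      (fun z : (X.carrier ⊕ X'.carrier) × Y.carrier =>
        (Sum.map (fun x => Quotient.mk (balancedSetoid X Y) (x, z.2))
          (fun x => Quotient.mk (balancedSetoid X' Y) (x, z.2)) z.1)) ?_,
    Sum.elim
      (Quotient.map (sb := balancedSetoid (X.sum X') Y) (fun z => (Sum.inl z.1, z.2)) ?_)
      (Quotient.map (sb := balancedSetoid (X.sum X') Y) (fun z => (Sum.inr z.1, z.2)) ?_),
    ?_, ?_⟩, ?_⟩
  · rintro ⟨x | x, y⟩ ⟨x', y'⟩ ⟨s, h1, h2⟩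
    · obtain rfl : x' = Sum.inl (((1, s) : S × S) • x) := h1
      exact congrArg Sum.inl (Quotient.sound ⟨s, rfl, h2⟩)
    · obtain rfl : x' = Sum.inr (((1, s) : S × S) • x) := h1
      exact congrArg Sum.inr (Quotient.sound ⟨s, rfl, h2⟩)
  · rintro ⟨x, y⟩ ⟨x', y'⟩ ⟨s, h1, h2⟩
    exact ⟨s, congrArg Sum.inl h1, h2⟩
  · rintro ⟨x, y⟩ ⟨x', y'⟩ ⟨s, h1, h2⟩
    exact ⟨s, congrArg Sum.inr h1, h2⟩
  · rintro ⟨x | x, y⟩ <;> rfl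
  · rintro (⟨x, y⟩ | ⟨x, y⟩) <;> rfl
  · rintro g ⟨x | x, y⟩ <;> rfl

theorem comp_sum (X Y Y' : FinGSet (S × S)) :
    (X.comp (Y.sum Y')).Iso ((X.comp Y).sum (X.comp Y')) := by
  refine ⟨⟨Quotient.lift
      (fun z : X.carrier × (Y.carrier ⊕ Y'.carrier) =>
        (Sum.map (fun y => Quotient.mk (balancedSetoid X Y) (z.1, y))
          (fun y => Quotient.mk (balancedSetoid X Y') (z.1, y)) z.2)) ?_,
    Sum.elim
      (Quotient.map (sb := balancedSetoid X (Y.sum Y')) (fun z => (z.1, Sum.inl z.2)) ?_)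
      (Quotient.map (sb := balancedSetoid X (Y.sum Y')) (fun z => (z.1, Sum.inr z.2)) ?_),
    ?_, ?_⟩, ?_⟩
  · rintro ⟨x, y | y⟩ ⟨x', y'⟩ ⟨s, h1, h2⟩
    · obtain rfl : y' = Sum.inl (((s, 1) : S × S) • y) := h2
      exact congrArg Sum.inl (Quotient.sound ⟨s, h1, rfl⟩)
    · obtain rfl : y' = Sum.inr (((s, 1) : S × S) • y) := h2
      exact congrArg Sum.inr (Quotient.sound ⟨s, h1, rfl⟩)
  · rintro ⟨x, y⟩ ⟨x', y'⟩ ⟨s, h1, h2⟩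
    exact ⟨s, h1, congrArg Sum.inl h2⟩
  · rintro ⟨x, y⟩ ⟨x', y'⟩ ⟨s, h1, h2⟩
    exact ⟨s, h1, congrArg Sum.inr h2⟩
  · rintro ⟨x, y | y⟩ <;> rfl
  · rintro (⟨x, y⟩ | ⟨x, y⟩) <;> rfl
  · rintro g ⟨x, y | y⟩ <;> rfl

end FinGSet

/-- Composition of bisets on isomorphism classes, biadditive. -/
def GSetClass.comp {S : Type u} [Group S] :
    GSetClass (S × S) →+ GSetClass (S × S) →+ GSetClass (S × S) where
  toFun x :=
    { toFun := Quotient.map₂ FinGSet.comp (fun _ _ h _ _ h' => FinGSet.comp_congr h h') x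
      map_zero' := by
        obtain ⟨X⟩ := x
        refine Quotient.sound ⟨⟨fun z => Quotient.lift (fun z => z.2.elim) ?_ z,
          fun z => z.elim, ?_, fun z => z.elim⟩, ?_⟩
        · rintro ⟨_, y⟩; exact y.elim
        · rintro ⟨_, y⟩; exact y.elim
        · rintro g ⟨_, y⟩; exact y.elim
      map_add' := by
        obtain ⟨X⟩ := x
        rintro ⟨Y⟩ ⟨Y'⟩
        exact Quotient.sound (FinGSet.comp_sum X Y Y') }
  map_zero' := by
    ext ⟨Y⟩
    refine Quotient.sound ⟨⟨fun z => Quotient.lift (fun z => z.1.elim) ?_ z,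
      fun z => z.elim, ?_, fun z => z.elim⟩, ?_⟩
    · rintro ⟨x, _⟩; exact x.elim
    · rintro ⟨x, _⟩; exact x.elim
    · rintro g ⟨x, _⟩; exact x.elim
  map_add' := by
    rintro ⟨X⟩ ⟨X'⟩
    ext ⟨Y⟩
    exact Quotient.sound (FinGSet.sum_comp X X' Y)

/-! ### Burnside groups and virtual bisets -/

/-- The additive group of the Burnside ring `B(G)`: the Grothendieck group of the monoid of
isomorphism classes of finite `G`-sets. For `G = S × S` it is the additive group of the double
Burnside ring `B(S,S)`. -/
abbrev BurnsideGroup (G : Type u) [Group G] : Type (u + 1) :=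
  Algebra.GrothendieckAddGroup (GSetClass G)

namespace BurnsideGroup

variable {G : Type u} [Group G]

/-- The class `[X]` of a finite `G`-set `X` in `B(G)`. -/
noncomputable def of (X : FinGSet G) : BurnsideGroup G :=
  Algebra.GrothendieckAddGroup.of (GSetClass.mk X)

theorem lift_of {A : Type*} [AddCommGroup A] (f : GSetClass G →+ A) (x : GSetClass G) :
    Algebra.GrothendieckAddGroup.lift f (Algebra.GrothendieckAddGroup.of x) = f x :=
  DFunLike.congr_fun (Algebra.GrothendieckAddGroup.lift.symm_apply_apply f) x

/-- Restriction `B(G) → B(H)` along a homomorphism `f : H → G`. -/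
noncomputable def restrict {H : Type u} [Group H] (f : H →* G) :
    BurnsideGroup G →+ BurnsideGroup H :=
  Algebra.GrothendieckAddGroup.lift (Algebra.GrothendieckAddGroup.of.comp (GSetClass.restrict f))

/-- The additive map `B(G) → ℤ` with `[X] ↦ |G \ X|`. -/
noncomputable def orbitCount : BurnsideGroup G →+ ℤ :=
  Algebra.GrothendieckAddGroup.lift GSetClass.orbitCount

/-- The product of the double Burnside ring `B(S,S)`: the biadditive map with
`[X] ∘ [Y] = [X ×_S Y]`. -/
noncomputable def comp {S : Type u} [Group S] :
    BurnsideGroup (S × S) →+ BurnsideGroup (S × S) →+ BurnsideGroup (S × S) :=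
  Algebra.GrothendieckAddGroup.lift
    { toFun := fun x => Algebra.GrothendieckAddGroup.lift
        (Algebra.GrothendieckAddGroup.of.comp (GSetClass.comp x))
      map_zero' := by
        apply Algebra.GrothendieckAddGroup.lift.symm.injective
        ext x
        simp
      map_add' := fun x y => by
        apply Algebra.GrothendieckAddGroup.lift.symm.injective
        ext z
        simp only [map_add, AddMonoidHom.add_apply, AddMonoidHom.comp_apply,
          Algebra.GrothendieckAddGroup.lift_symm_apply, BurnsideGroup.lift_of] }

end BurnsideGroup

/-- The ring `ℤ_(p)` of rational numbers with denominator prime to `p`. -/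
def ZLocal (p : ℕ) [Fact p.Prime] : Subring ℚ where
  carrier := {q | ¬ p ∣ q.den}
  mul_mem' {a b} ha hb h := by
    rcases (Fact.out : p.Prime).dvd_mul.1 (h.trans (Rat.mul_den_dvd a b)) with h | h
    exacts [ha h, hb h]
  one_mem' := by simpa using (Fact.out : p.Prime).one_lt.ne'
  add_mem' {a b} ha hb h := by
    rcases (Fact.out : p.Prime).dvd_mul.1 (h.trans (Rat.add_den_dvd a b)) with h | h
    exacts [ha h, hb h]
  zero_mem' := by simpa using (Fact.out : p.Prime).one_lt.ne'
  neg_mem' {a} ha := by simpa using ha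

/-- `ℤ_(p) ⊗ B(G)`: virtual `G`-sets with coefficients in `ℤ_(p)`. For `G = S × S` its elements
are the virtual `(S,S)`-bisets with coefficients in `ℤ_(p)`. -/
abbrev LocalBurnside (p : ℕ) [Fact p.Prime] (G : Type u) [Group G] : Type (u + 1) :=
  ZLocal p ⊗[ℤ] BurnsideGroup G

namespace LocalBurnside

variable {p : ℕ} [Fact p.Prime] {G : Type u} [Group G]

/-- The class `[X]` of a finite `G`-set `X` in `ℤ_(p) ⊗ B(G)`. -/
noncomputable def of (X : FinGSet G) : LocalBurnside p G := 1 ⊗ₜ[ℤ] BurnsideGroup.of X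

/-- The `ℤ_(p)`-linear extension of restriction along `f : H → G`. -/
noncomputable def restrict {H : Type u} [Group H] (f : H →* G) :
    LocalBurnside p G →ₗ[ZLocal p] LocalBurnside p H :=
  LinearMap.baseChange (ZLocal p) (BurnsideGroup.restrict f).toIntLinearMap

/-- The linearized number of orbits: the `ℤ_(p)`-linear map with `[X] ↦ |G \ X|`. -/
noncomputable def orbitCount : LocalBurnside p G →ₗ[ZLocal p] ZLocal p :=
  (TensorProduct.AlgebraTensorModule.rid ℤ (ZLocal p) (ZLocal p)).toLinearMap ∘ₗ
    LinearMap.baseChange (ZLocal p) BurnsideGroup.orbitCount.toIntLinearMap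

/-- The product `∘` of the double Burnside ring `ℤ_(p) ⊗ B(S,S)`: the `ℤ_(p)`-bilinear map with
`[X] ∘ [Y] = [X ×_S Y]`. -/
noncomputable def comp {S : Type u} [Group S] :
    LocalBurnside p (S × S) →ₗ[ZLocal p] LocalBurnside p (S × S) →ₗ[ZLocal p]
      LocalBurnside p (S × S) :=
  LinearMap.BilinMap.baseChange (ZLocal p)
    (LinearMap.mk₂ ℤ (fun x y => BurnsideGroup.comp x y)
      (fun x y z => by rw [map_add, AddMonoidHom.add_apply])
      (fun n x y => by rw [map_zsmul, AddMonoidHom.zsmul_apply])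
      (fun x y z => map_add _ _ _)
      (fun n x y => map_zsmul _ _ _))

/-- The linearized number `|P \ ω / Q|` of `(P,Q)`-orbits of a virtual `(S,S)`-biset `ω`. -/
noncomputable def doubleOrbitCount {S : Type u} [Group S] (ω : LocalBurnside p (S × S))
    (P Q : Subgroup S) : ZLocal p :=
  orbitCount (restrict (P.subtype.prodMap Q.subtype) ω)

end LocalBurnside

/-! ### Saturated fusion systems -/

/-- A fusion system on `S`. `Hom P` is the set of morphisms `P → S` of the fusion system,
and `Hom(P, Q)` is the set of `φ : P → Q` whose composite with the inclusion `Q → S` lies in `Hom P`.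
-/
structure FusionSystem (S : Type u) [Group S] where
  Hom : (P : Subgroup S) → Set (P →* S)
  injective : ∀ {P : Subgroup S} {φ : P →* S}, φ ∈ Hom P → Function.Injective φ
  /-- Conjugations by elements of `S` are morphisms; in particular inclusions are. -/
  conj_mem : ∀ (P : Subgroup S) (s : S), (MulAut.conj s).toMonoidHom.comp P.subtype ∈ Hom P
  /-- Morphisms compose. -/
  comp_mem : ∀ {P Q : Subgroup S} {φ : P →* S} {ψ : Q →* S} (h : ∀ x, φ x ∈ Q),
    φ ∈ Hom P → ψ ∈ Hom Q → ψ.comp (φ.codRestrict Q h) ∈ Hom P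
  /-- Every morphism is an isomorphism onto its image. -/
  exists_inverse : ∀ {P : Subgroup S} {φ : P →* S}, φ ∈ Hom P →
    ∃ ψ ∈ Hom φ.range, ∀ x : P, ψ (φ.rangeRestrict x) = x

namespace FusionSystem

variable {S : Type u} [Group S] (F : FusionSystem S)

theorem subtype_mem (P : Subgroup S) : P.subtype ∈ F.Hom P := by
  have h := F.conj_mem P 1
  have e : (MulAut.conj (1 : S)).toMonoidHom.comp P.subtype = P.subtype := by ext; simp
  rwa [e] at h

theorem comp_mem' {P Q : Subgroup S} {φ : P →* S} {ψ : Q →* S} {θ : P →* S} (hφ : φ ∈ F.Hom P)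
    (hψ : ψ ∈ F.Hom Q) (h : ∀ x, ∃ hx : φ x ∈ Q, θ x = ψ ⟨φ x, hx⟩) : θ ∈ F.Hom P := by
  have e : θ = ψ.comp (φ.codRestrict Q fun x => (h x).1) := by
    ext x
    exact (h x).2
  rw [e]
  exact F.comp_mem _ hφ hψ

/-- `P` and `Q` are `F`-conjugate: `Q` is the image of a morphism `P → S` of `F`. -/
def IsConj (P Q : Subgroup S) : Prop := ∃ φ ∈ F.Hom P, φ.range = Q

/-- `F`-conjugacy is an equivalence relation. -/
def conjSetoid : Setoid (Subgroup S) where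
  r := F.IsConj
  iseqv := by
    refine ⟨fun P => ⟨P.subtype, F.subtype_mem P, P.range_subtype⟩, ?_, ?_⟩
    · rintro P _ ⟨φ, hφ, rfl⟩
      obtain ⟨ψ, hψ, h⟩ := F.exists_inverse hφ
      refine ⟨ψ, hψ, ?_⟩
      ext x
      constructor
      · rintro ⟨⟨_, y, rfl⟩, rfl⟩
        have := h y
        rw [show (⟨φ y, y, rfl⟩ : φ.range) = φ.rangeRestrict y from rfl, this]
        exact y.2
      · intro hx
        exact ⟨_, h ⟨x, hx⟩⟩
    · rintro P _ _ ⟨φ, hφ, rfl⟩ ⟨ψ, hψ, rfl⟩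
      refine ⟨_, F.comp_mem (fun x => (⟨x, rfl⟩ : φ x ∈ φ.range)) hφ hψ, ?_⟩
      ext x
      constructor
      · rintro ⟨y, rfl⟩
        exact ⟨_, rfl⟩
      · rintro ⟨⟨_, y, rfl⟩, rfl⟩
        exact ⟨y, rfl⟩

/-- The `F`-conjugacy classes of subgroups of `S`. -/
abbrev SubgroupClass : Type u := Quotient F.conjSetoid

/-- The `F`-conjugacy class of a subgroup. -/
def classOf (P : Subgroup S) : F.SubgroupClass := Quotient.mk F.conjSetoid P

noncomputable instance [Finite S] : Fintype F.SubgroupClass := Fintype.ofFinite _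

/-- The `F`-conjugacy classes of cyclic subgroups of `S`. -/
def cyclicClasses : Set F.SubgroupClass := {c | ∃ P : Subgroup S, IsCyclic P ∧ F.classOf P = c}

/-- `Aut_F(P)`, as a subgroup of the automorphism group of `P`. -/
def aut (P : Subgroup S) : Subgroup (MulAut P) where
  carrier := {α | P.subtype.comp α.toMonoidHom ∈ F.Hom P}
  one_mem' := F.subtype_mem P
  mul_mem' {α β} hα hβ := F.comp_mem' hβ hα fun x => ⟨(β x).2, rfl⟩
  inv_mem' {α} hα := by
    obtain ⟨ψ, hψ, h⟩ := F.exists_inverse hα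
    have key : ∀ x : P, P.subtype.comp α.toMonoidHom (α⁻¹ x) = P.subtype x := fun x =>
      congrArg Subtype.val (MulAut.apply_inv_self P α x)
    refine F.comp_mem' (F.subtype_mem P) hψ fun x => ⟨⟨α⁻¹ x, key x⟩, ?_⟩
    exact (h (α⁻¹ x)).symm.trans (congrArg ψ (Subtype.ext (key x)))

/-- `Aut_S(P)`: the automorphisms of `P` induced by conjugation by elements of `N_S(P)`. -/
def autS (P : Subgroup S) : Subgroup (MulAut P) := P.normalizerMonoidHom.range

/-- `P` is fully normalized: `|N_S(P)| ≥ |N_S(P')|` for all `P'` which are `F`-conjugate to `P`. -/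
def FullyNormalized (P : Subgroup S) : Prop :=
  ∀ P' : Subgroup S, F.IsConj P P' →
    Nat.card (Subgroup.normalizer (P' : Set S)) ≤ Nat.card (Subgroup.normalizer (P : Set S))

/-- `P` is fully centralized: `|C_S(P)| ≥ |C_S(P')|` for all `P'` which are `F`-conjugate to `P`. -/
def FullyCentralized (P : Subgroup S) : Prop :=
  ∀ P' : Subgroup S, F.IsConj P P' →
    Nat.card (Subgroup.centralizer (P' : Set S)) ≤ Nat.card (Subgroup.centralizer (P : Set S))

/-- For `φ : P → S`, the subgroup `N_φ` of those `g ∈ N_S(P)` such that `φ c_g φ⁻¹ ∈ Aut_S(φ(P))`,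
i.e. such that for some `h ∈ N_S(φ(P))`, `φ(g x g⁻¹) = h φ(x) h⁻¹` for all `x ∈ P`. -/
def extender {P : Subgroup S} (φ : P →* S) : Subgroup S where
  carrier := {g | ∃ hg : g ∈ Subgroup.normalizer (P : Set S),
    ∃ h ∈ Subgroup.normalizer (φ.range : Set S),
      ∀ x : P, φ (P.normalizerMonoidHom ⟨g, hg⟩ x) = h * φ x * h⁻¹}
  one_mem' := ⟨one_mem _, 1, one_mem _, fun x => by
    rw [show (⟨1, one_mem _⟩ : Subgroup.normalizer (P : Set S)) = 1 from rfl, map_one]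
    simp⟩
  mul_mem' := by
    rintro a b ⟨ha, h, hh, e⟩ ⟨hb, k, hk, f⟩
    refine ⟨mul_mem ha hb, h * k, mul_mem hh hk, fun x => ?_⟩
    rw [show (⟨a * b, mul_mem ha hb⟩ : Subgroup.normalizer (P : Set S)) = ⟨a, ha⟩ * ⟨b, hb⟩ from rfl,
      map_mul, MulAut.mul_apply, e, f]
    group
  inv_mem' := by
    rintro a ⟨ha, h, hh, e⟩
    refine ⟨inv_mem ha, h⁻¹, inv_mem hh, fun x => ?_⟩
    have := e (P.normalizerMonoidHom ⟨a⁻¹, inv_mem ha⟩ x)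
    rw [show (⟨a⁻¹, inv_mem ha⟩ : Subgroup.normalizer (P : Set S)) = ⟨a, ha⟩⁻¹ from rfl,
      map_inv, MulAut.apply_inv_self] at this
    rw [show (⟨a⁻¹, inv_mem ha⟩ : Subgroup.normalizer (P : Set S)) = ⟨a, ha⟩⁻¹ from rfl,
      map_inv, this]
    group

theorem le_extender {P : Subgroup S} (φ : P →* S) : P ≤ extender φ := by
  intro g hg
  refine ⟨Subgroup.le_normalizer hg, φ ⟨g, hg⟩, Subgroup.le_normalizer ⟨⟨g, hg⟩, rfl⟩, fun x => ?_⟩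
  rw [← map_inv, ← map_mul, ← map_mul]
  rfl

/-- A fusion system on a finite `p`-group is saturated if
(I) whenever `P` is fully normalized, `P` is fully centralized and `Aut_S(P)` is a Sylow
`p`-subgroup of `Aut_F(P)`;
(II) every morphism `φ : P → S` with fully centralized image extends to a morphism `N_φ → S`. -/
structure IsSaturated (p : ℕ) : Prop where
  sylow : ∀ P : Subgroup S, F.FullyNormalized P → F.FullyCentralized P ∧
    ∃ A : Sylow p (F.aut P), (A : Subgroup (F.aut P)) = (autS P).subgroupOf (F.aut P)
  extension : ∀ (P : Subgroup S), ∀ φ ∈ F.Hom P, F.FullyCentralized φ.range →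
    ∃ ψ ∈ F.Hom (extender φ), ψ.comp (Subgroup.inclusion (le_extender φ)) = φ

/-! ### The characteristic idempotent -/

variable {p : ℕ} [Fact p.Prime]

/-- A virtual `(S,S)`-biset is `F`-stable if it is stable for the product fusion system `F × F` on
`S × S`, whose morphisms are the restrictions of the maps `φ × ψ : P × Q → S × S` with `φ : P → S`
and `ψ : Q → S` in `F`: restriction along `φ × ψ` and along the inclusion give the same
virtual `P × Q`-set. -/
def IsStable (ω : LocalBurnside p (S × S)) : Prop :=
  ∀ (P Q : Subgroup S), ∀ φ ∈ F.Hom P, ∀ ψ ∈ F.Hom Q,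
    LocalBurnside.restrict (φ.prodMap ψ) ω =
      LocalBurnside.restrict (P.subtype.prodMap Q.subtype) ω

/-- The twisted diagonal `Δ(P, φ) = {(u, φ(u)) | u ∈ P}`. -/
def twistedDiagonal {P : Subgroup S} (φ : P →* S) : Subgroup (S × S) := (P.subtype.prod φ).range

/-- A virtual `(S,S)`-biset is `F`-generated if it is a linear combination of transitive
`(S,S)`-bisets `(S × S)/Δ(P, φ)` with `φ : P → S` in `F`. -/
def IsGenerated [Finite S] (ω : LocalBurnside p (S × S)) : Prop :=
  ω ∈ Submodule.span (ZLocal p)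
    {x | ∃ P : Subgroup S, ∃ φ ∈ F.Hom P,
      x = LocalBurnside.of (FinGSet.cosets (twistedDiagonal φ))}

/-- `ω` is the characteristic idempotent of `F`: the (unique) nonzero virtual `(S,S)`-biset with
coefficients in `ℤ_(p)` which is `F`-stable, `F`-generated and idempotent in the double Burnside
ring. -/
structure IsCharacteristicIdempotent [Finite S] (ω : LocalBurnside p (S × S)) : Prop where
  stable : F.IsStable ω
  generated : F.IsGenerated ω
  idempotent : LocalBurnside.comp ω ω = ω
  ne_zero : ω ≠ 0

end FusionSystem

/-!
For `a, b : S` let `f(a, b)` be the linearized number of points of `ω` fixed by `(a, b)`. By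
Burnside's orbit counting lemma, `|P| |Q| |P \ ω / Q|` is the sum of `f(a, b)` over `a ∈ P` and
`b ∈ Q` (`FusionSystem.card_mul_doubleOrbitCount`). Since `ω` is `F`-generated, `f(a, b)` vanishes
unless `b` is the image of `a` under a morphism of `F`, and then, since `ω` is `F`-stable, it equals
the mark `c(⟨a⟩)` of `ω` at the diagonal of `⟨a⟩`. The sum of `f(a, b)` over `b ∈ Q` depends only on
the `F`-conjugacy class of the cyclic subgroup `⟨a⟩` (`FusionSystem.IsStable.markSum_congr`), so the
matrix is a product `B * N` whose inner index runs over the classes of cyclic subgroups. Ordering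
these by the order of the subgroups, the square blocks of `B` and `N` at cyclic subgroups are
triangular. The diagonal entries of `N` are positive multiples of the marks `c(⟨a⟩)`, so everything
rests on these marks being nonzero.

This nonvanishing (`FusionSystem.IsCharacteristicIdempotent.diagonalMark_ne_zero`) is proved for
all `P ≤ S` at once. Let `e(P)` be the linearized number of `P`-fixed points of `ω/S`. On marks at
twisted diagonals, composition of right-free bisets is matrix multiplication up to the factor `|S|`
(`LocalBurnside.card_mul_mark_comp`). This gives `|S| e(P) = |Hom_F(P, S)| c(P)` and, as `ω` is
idempotent, `e(P)² = e(P)`. Since `P` is a `p`-group, `e(P)` is congruent modulo `p` to the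
linearized cardinality of `ω/S`, so either `e(P) = 0` for all `P` or `e(P) = 1` for all `P`. In the
first case all marks of `ω` vanish, and marks separate virtual sets
(`LocalBurnside.eq_zero_of_mark_eq_zero`), contradicting `ω ≠ 0`.
-/

/-! ### Marks -/

namespace FinGSet

variable {G : Type u} [Group G]

/-- The number of points of `X` fixed by every element of `T`. -/
noncomputable def fixedCard (T : Set G) (X : FinGSet G) : ℕ :=
  Nat.card {x : X.carrier // ∀ g ∈ T, g • x = x}

theorem fixedCard_congr (T : Set G) {X Y : FinGSet G} :
    X.Iso Y → X.fixedCard T = Y.fixedCard T := by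
  rintro ⟨e, he⟩
  refine Nat.card_congr (e.subtypeEquiv fun x => ?_)
  simp only [← he, e.injective.eq_iff]

theorem fixedCard_sum (T : Set G) (X Y : FinGSet G) :
    (X.sum Y).fixedCard T = X.fixedCard T + Y.fixedCard T := by
  rw [fixedCard, fixedCard, fixedCard, ← Nat.card_sum]
  refine Nat.card_congr ((Equiv.subtypeSum
    (p := fun x : X.carrier ⊕ Y.carrier => ∀ g ∈ T, (g • x : X.carrier ⊕ Y.carrier) = x)).trans
    (Equiv.sumCongr (Equiv.subtypeEquivRight fun x => ?_) (Equiv.subtypeEquivRight fun x => ?_)))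
  · exact forall₂_congr fun g _ => Sum.inl_injective.eq_iff
  · exact forall₂_congr fun g _ => Sum.inr_injective.eq_iff

theorem fixedCard_restrict {H : Type u} [Group H] (f : H →* G) (T : Set H) (X : FinGSet G) :
    (X.restrict f).fixedCard T = X.fixedCard (f '' T) :=
  Nat.card_congr (Equiv.subtypeEquivRight fun (x : X.carrier) =>
    (Set.forall_mem_image (f := f) (p := fun g => g • x = x)).symm)

theorem fixedCard_eq_zero {T : Set G} {X : FinGSet G}
    (h : ∀ x : X.carrier, ¬ ∀ g ∈ T, g • x = x) : X.fixedCard T = 0 := by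
  have : IsEmpty {x : X.carrier // ∀ g ∈ T, g • x = x} := ⟨fun x => h _ x.2⟩
  exact Nat.card_of_isEmpty

end FinGSet

/-- The number of points fixed by every element of `T`, on isomorphism classes. -/
noncomputable def GSetClass.mark {G : Type u} [Group G] (T : Set G) : GSetClass G →+ ℤ where
  toFun := Quotient.lift (fun X : FinGSet G => (X.fixedCard T : ℤ))
    fun _ _ h => congrArg Nat.cast (FinGSet.fixedCard_congr T h)
  map_zero' := congrArg Nat.cast (FinGSet.fixedCard_eq_zero fun x => x.elim)
  map_add' := by
    rintro ⟨X⟩ ⟨Y⟩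
    change (((X.sum Y).fixedCard T : ℕ) : ℤ) = X.fixedCard T + Y.fixedCard T
    rw [FinGSet.fixedCard_sum, Nat.cast_add]

namespace LocalBurnside

variable {p : ℕ} [Fact p.Prime] {G : Type u} [Group G]

/-- The `ℤ_(p)`-linear extension of an additive invariant of finite `G`-sets. -/
noncomputable def linearExtension (f : GSetClass G →+ ℤ) : LocalBurnside p G →ₗ[ZLocal p] ZLocal p :=
  (TensorProduct.AlgebraTensorModule.rid ℤ (ZLocal p) (ZLocal p)).toLinearMap ∘ₗ
    LinearMap.baseChange (ZLocal p)
      (Algebra.GrothendieckAddGroup.lift f : BurnsideGroup G →+ ℤ).toIntLinearMap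

theorem linearExtension_of (f : GSetClass G →+ ℤ) (X : FinGSet G) :
    linearExtension (p := p) f (of X) = (f (GSetClass.mk X) : ZLocal p) := by
  simp only [linearExtension, of, BurnsideGroup.of, LinearMap.comp_apply,
    LinearMap.baseChange_tmul, AddMonoidHom.coe_toIntLinearMap, BurnsideGroup.lift_of]
  simp

/-- The linearized number of points fixed by every element of `T`. If `T` is a subgroup, this is
the mark of `T`. -/
noncomputable def mark (T : Set G) : LocalBurnside p G →ₗ[ZLocal p] ZLocal p :=
  linearExtension (GSetClass.mark T)

@[simp]
theorem mark_of (T : Set G) (X : FinGSet G) :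
    mark (p := p) T (of X) = (X.fixedCard T : ZLocal p) := by
  rw [mark, linearExtension_of]
  exact Int.cast_natCast _

@[simp]
theorem orbitCount_of (X : FinGSet G) :
    orbitCount (p := p) (of X) = (Nat.card X.Orbits : ZLocal p) := by
  refine (linearExtension_of GSetClass.orbitCount X).trans ?_
  exact Int.cast_natCast _

@[simp]
theorem restrict_of {H : Type u} [Group H] (f : H →* G) (X : FinGSet G) :
    restrict (p := p) f (of X) = of (X.restrict f) := by
  simp only [restrict, of, BurnsideGroup.of, BurnsideGroup.restrict, LinearMap.baseChange_tmul,
    AddMonoidHom.coe_toIntLinearMap, BurnsideGroup.lift_of]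
  rfl

@[simp]
theorem comp_of {S : Type u} [Group S] (X Y : FinGSet (S × S)) :
    comp (p := p) (of X) (of Y) = of (X.comp Y) := by
  simp only [comp, of, BurnsideGroup.of, BurnsideGroup.comp, LinearMap.BilinMap.baseChange_tmul,
    LinearMap.mk₂_apply, BurnsideGroup.lift_of, mul_one]
  erw [BurnsideGroup.lift_of]
  rfl

/-- A linear map out of `ℤ_(p) ⊗ B(G)` is determined by its values on finite `G`-sets. -/
theorem hom_ext {M : Type*} [AddCommGroup M] [Module (ZLocal p) M]
    {f g : LocalBurnside p G →ₗ[ZLocal p] M} (h : ∀ X, f (of X) = g (of X)) : f = g := by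
  refine TensorProduct.AlgebraTensorModule.curry_injective (LinearMap.ext_ring ?_)
  have : (f.toAddMonoidHom.comp (TensorProduct.mk ℤ (ZLocal p) (BurnsideGroup G) 1).toAddMonoidHom)
      = g.toAddMonoidHom.comp (TensorProduct.mk ℤ (ZLocal p) (BurnsideGroup G) 1).toAddMonoidHom := by
    apply Algebra.GrothendieckAddGroup.lift.symm.injective
    ext ⟨X⟩
    exact h X
  ext x
  exact DFunLike.congr_fun this x

theorem mark_restrict {H : Type u} [Group H] (f : H →* G) (T : Set H) (ω : LocalBurnside p G) :
    mark T (restrict f ω) = mark (f '' T) ω := by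
  suffices (mark T) ∘ₗ restrict f = mark (p := p) (f '' T) from DFunLike.congr_fun this ω
  refine hom_ext fun X => ?_
  simp [FinGSet.fixedCard_restrict]

/-- Burnside's orbit counting lemma. -/
theorem card_mul_orbitCount [Fintype G] (ω : LocalBurnside p G) :
    (Nat.card G : ZLocal p) * orbitCount ω = ∑ g : G, mark {g} ω := by
  classical
  suffices (Nat.card G : ZLocal p) • orbitCount (p := p) = ∑ g : G, mark {g} by
    simpa using DFunLike.congr_fun this ω
  refine hom_ext fun X => ?_
  have : Fintype X.carrier := Fintype.ofFinite _
  have : Fintype X.Orbits := Fintype.ofFinite _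
  have := MulAction.sum_card_fixedBy_eq_card_orbits_mul_card_group G X.carrier
  simp only [LinearMap.smul_apply, LinearMap.sum_apply, orbitCount_of, mark_of, smul_eq_mul]
  rw [Nat.card_eq_fintype_card, Nat.card_eq_fintype_card, ← Nat.cast_mul, mul_comm, ← this,
    Nat.cast_sum]
  refine Finset.sum_congr rfl fun g _ => congrArg _ ?_
  rw [FinGSet.fixedCard, ← Nat.card_eq_fintype_card]
  exact Nat.card_congr (Equiv.subtypeEquivRight fun x => by simp)

/-- A `p`-group acting on a finite set has, modulo `p`, as many fixed points as the set has points;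
the latter number is the mark at the empty set. -/
theorem dvd_mark_range_sub_mark_empty {P : Type u} [Group P] [Finite P] (hP : IsPGroup p P)
    (f : P →* G) (ω : LocalBurnside p G) :
    (p : ZLocal p) ∣ mark (Set.range f) ω - mark ∅ ω := by
  rw [← Ideal.mem_span_singleton, ← Ideal.Quotient.eq_zero_iff_mem]
  suffices (Submodule.mkQ (Ideal.span {(p : ZLocal p)})) ∘ₗ
      (mark (Set.range f) - mark (p := p) (∅ : Set G)) = 0 from DFunLike.congr_fun this ω
  refine hom_ext fun X => ?_
  simp only [LinearMap.comp_apply, LinearMap.sub_apply, mark_of, LinearMap.zero_apply]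
  refine (Submodule.Quotient.mk_eq_zero _).2 (Ideal.mem_span_singleton.2 ?_)
  have h := hP.card_modEq_card_fixedPoints (X.restrict f).carrier
  have h₁ : Nat.card (MulAction.fixedPoints P (X.restrict f).carrier) =
      X.fixedCard (Set.range f) :=
    Nat.card_congr (Equiv.subtypeEquivRight fun (x : X.carrier) =>
      (Set.forall_mem_range (f := f) (p := fun g => g • x = x)).symm)
  have h₂ : Nat.card (X.restrict f).carrier = X.fixedCard ∅ :=
    Nat.card_congr (Equiv.subtypeUnivEquiv fun x g hg => hg.elim).symm
  rw [h₁, h₂, Nat.modEq_iff_dvd] at h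
  simpa using (Int.castRingHom (ZLocal p)).map_dvd h

end LocalBurnside

/-! ### Fixed points of composites -/

namespace FinGSet

variable {S : Type u} [Group S]

/-- The right action of `S` on the biset `X` is free. -/
def RightFree (X : FinGSet (S × S)) : Prop :=
  ∀ (s : S) (x : X.carrier), ((1, s) : S × S) • x = x → s = 1

theorem RightFree.eq_of_smul_eq {X : FinGSet (S × S)} (hX : X.RightFree) {s t : S} {x : X.carrier}
    (h : ((1, s) : S × S) • x = ((1, t) : S × S) • x) : s = t := by
  have := hX (t⁻¹ * s) x (by
    rw [show ((1, t⁻¹ * s) : S × S) = (1, t)⁻¹ * (1, s) by simp, mul_smul, h, inv_smul_smul])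
  exact (inv_mul_eq_one.1 this).symm

/-- The class `[x, y]` in `X ×_S Y`. -/
def compMk (X Y : FinGSet (S × S)) (z : X.carrier × Y.carrier) : (X.comp Y).carrier :=
  Quotient.mk (balancedSetoid X Y) z

theorem compMk_eq {X Y : FinGSet (S × S)} {z w : X.carrier × Y.carrier} :
    compMk X Y z = compMk X Y w ↔
      ∃ s : S, w.1 = ((1, s) : S × S) • z.1 ∧ w.2 = ((s, 1) : S × S) • z.2 :=
  ⟨Quotient.exact, fun h => Quotient.sound h⟩

/-- If `X` is right-free then a pair `(x, y)` representing a point of `X ×_S Y` fixed by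
`(α u, θ u)` for all `u` determines a homomorphism `φ : P → S` with `α(u) x = x φ(u)` and
`φ(u) y = y θ(u)`; moreover each point is represented by exactly `|S|` pairs. -/
theorem card_mul_fixedCard_comp [Finite S] {P : Type u} [Group P] [Fintype (P →* S)]
    {X Y : FinGSet (S × S)} (hX : X.RightFree) (α θ : P →* S) :
    Nat.card S * (X.comp Y).fixedCard (Set.range (α.prod θ)) =
      ∑ φ : P →* S, X.fixedCard (Set.range (α.prod φ)) * Y.fixedCard (Set.range (φ.prod θ)) := by
  let C := {q : (X.comp Y).carrier // ∀ g ∈ Set.range (α.prod θ), g • q = q}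
  let T := {z : X.carrier × Y.carrier // ∀ g ∈ Set.range (α.prod θ),
    g • compMk X Y z = compMk X Y z}
  let A (φ : P →* S) := {x : X.carrier // ∀ g ∈ Set.range (α.prod φ), g • x = x}
  let B (φ : P →* S) := {y : Y.carrier // ∀ g ∈ Set.range (φ.prod θ), g • y = y}
  have h₁ : Nat.card (S × C) = Nat.card T := by
    refine Nat.card_congr (Equiv.ofBijective (fun w => ⟨(((1, w.1) : S × S) • w.2.1.out.1,
      ((w.1, 1) : S × S) • w.2.1.out.2), ?_⟩) ⟨?_, ?_⟩)
    · have : compMk X Y (((1, w.1) : S × S) • w.2.1.out.1,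
          ((w.1, 1) : S × S) • w.2.1.out.2) = w.2.1 :=
        (compMk_eq.2 ⟨w.1, rfl, rfl⟩).symm.trans w.2.1.out_eq
      rw [this]
      exact w.2.2
    · rintro ⟨s, q, hq⟩ ⟨t, r, hr⟩ h
      have h' := congrArg Subtype.val h
      dsimp only at h'
      obtain rfl : q = r := by
        rw [← q.out_eq, ← r.out_eq]
        exact (compMk_eq.2 ⟨s, rfl, rfl⟩).trans
          ((congrArg _ h').trans (compMk_eq.2 ⟨t, rfl, rfl⟩).symm)
      rw [hX.eq_of_smul_eq (congrArg Prod.fst h')]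
    · rintro ⟨z, hz⟩
      obtain ⟨s, hs, hs'⟩ := compMk_eq.1 (Quotient.out_eq (compMk X Y z))
      exact ⟨(s, ⟨compMk X Y z, hz⟩), Subtype.ext (Prod.ext hs.symm hs'.symm)⟩
  have h₂ : Nat.card (Σ φ, A φ × B φ) = Nat.card T := by
    refine Nat.card_congr (Equiv.ofBijective (fun w => ⟨(w.2.1.1, w.2.2.1), ?_⟩) ⟨?_, ?_⟩)
    · rintro _ ⟨u, rfl⟩
      refine (compMk_eq.2 ⟨w.1 u, ?_, ?_⟩)
      · simpa [smul_smul] using (w.2.1.2 _ ⟨u, rfl⟩).symm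
      · simpa [smul_smul] using (w.2.2.2 _ ⟨u, rfl⟩).symm
    · rintro ⟨φ, ⟨x, hx⟩, ⟨y, hy⟩⟩ ⟨ψ, ⟨x', hx'⟩, ⟨y', hy'⟩⟩ h
      have h' := congrArg Subtype.val h
      dsimp only at h'
      obtain ⟨rfl, rfl⟩ := Prod.ext_iff.1 h'
      obtain rfl : φ = ψ := by
        ext u
        have e₁ : ((α u, φ u) : S × S) • x = x := hx _ ⟨u, rfl⟩
        have e₂ : ((α u, ψ u) : S × S) • x = x := hx' _ ⟨u, rfl⟩
        refine hX.eq_of_smul_eq (x := ((α u, 1) : S × S) • x) ?_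
        simpa [smul_smul] using e₁.trans e₂.symm
      rfl
    · rintro ⟨⟨x, y⟩, hz⟩
      have hz' (u : P) := compMk_eq.1 (hz _ ⟨u, rfl⟩)
      choose f hf hf' using hz'
      have hf (u : P) : ((α u, f u) : S × S) • x = x := by
        simpa [smul_smul] using (hf u).symm
      have hf' (u : P) : ((f u, θ u) : S × S) • y = y := by
        simpa [smul_smul] using (hf' u).symm
      let φ : P →* S := MonoidHom.mk' f fun u v => by
        refine hX.eq_of_smul_eq (x := ((α (u * v), 1) : S × S) • x) ?_
        have := hf u
        conv_lhs at this => rw [← hf v]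
        simpa [smul_smul] using (hf (u * v)).trans this.symm
      exact ⟨⟨φ, ⟨x, by rintro _ ⟨u, rfl⟩; exact hf u⟩, ⟨y, by rintro _ ⟨u, rfl⟩; exact hf' u⟩⟩, rfl⟩
  have h₃ := h₁.trans h₂.symm
  rw [Nat.card_prod, Nat.card_sigma] at h₃
  simp only [Nat.card_prod] at h₃
  exact h₃

/-- The one-point `G`-set. -/
def point (G : Type u) [Group G] : FinGSet G where
  carrier := PUnit
  action := { smul := fun _ x => x, one_smul := fun _ => rfl, mul_smul := fun _ _ _ => rfl }

theorem fixedCard_point {G : Type u} [Group G] (T : Set G) : (point G).fixedCard T = 1 := by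
  rw [fixedCard, Nat.card_eq_one_iff_unique]
  exact ⟨⟨fun x y => Subtype.ext (Subsingleton.elim (α := PUnit) x.1 y.1)⟩,
    ⟨⟨PUnit.unit, fun _ _ => rfl⟩⟩⟩

end FinGSet

namespace LocalBurnside

variable {p : ℕ} [Fact p.Prime] {S : Type u} [Group S]

/-- The marks of a composite at twisted diagonals: for `ω` in the span of the right-free bisets,
composition acts on marks by matrix multiplication, up to the factor `|S|`. -/
theorem card_mul_mark_comp [Finite S] {P : Type u} [Group P] [Fintype (P →* S)]
    {ω : LocalBurnside p (S × S)}
    (hω : ω ∈ Submodule.span (ZLocal p) {x | ∃ X : FinGSet (S × S), X.RightFree ∧ x = of X})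
    (ω' : LocalBurnside p (S × S)) (α θ : P →* S) :
    (Nat.card S : ZLocal p) * mark (Set.range (α.prod θ)) (comp ω ω') =
      ∑ φ : P →* S, mark (Set.range (α.prod φ)) ω * mark (Set.range (φ.prod θ)) ω' := by
  induction hω using Submodule.span_induction with
  | mem x hx =>
    obtain ⟨X, hX, rfl⟩ := hx
    suffices LinearMap.mulLeft (ZLocal p) (Nat.card S : ZLocal p) ∘ₗ
          mark (Set.range (α.prod θ)) ∘ₗ comp (of X) =
        ∑ φ : P →* S, mark (p := p) (Set.range (α.prod φ)) (of X) •
          mark (Set.range (φ.prod θ)) by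
      simpa using DFunLike.congr_fun this ω'
    refine hom_ext fun Y => ?_
    have := congrArg (Nat.cast (R := ZLocal p)) (FinGSet.card_mul_fixedCard_comp (Y := Y) hX α θ)
    simpa using this
  | zero => simp
  | add x y _ _ hx hy => simp [mul_add, add_mul, Finset.sum_add_distrib, hx, hy]
  | smul c x _ hx =>
    simp only [map_smul, LinearMap.smul_apply, smul_eq_mul, mul_assoc, ← Finset.mul_sum, ← hx]
    ring

end LocalBurnside

/-! ### Marks separate virtual sets -/

namespace FinGSet

variable {G : Type u} [Group G]

theorem smul_mk_eq_iff {K : Subgroup G} {T : Set G} (x : G) :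
    (∀ g ∈ T, g • (x : G ⧸ K) = x) ↔ ∀ g ∈ T, x⁻¹ * g * x ∈ K := by
  refine forall₂_congr fun g _ => ?_
  change (((g * x : G) : G ⧸ K) = (x : G ⧸ K)) ↔ _
  rw [eq_comm, QuotientGroup.eq, mul_assoc]

variable [Finite G]

theorem exists_conj_mem_of_fixedCard_ne_zero {K : Subgroup G} {T : Set G}
    (h : (cosets K).fixedCard T ≠ 0) : ∃ x : G, ∀ g ∈ T, x⁻¹ * g * x ∈ K := by
  by_contra! hx
  refine h (fixedCard_eq_zero fun z hz => ?_)
  induction z using Quotient.inductionOn' with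
  | h x =>
    obtain ⟨g, hg, hg'⟩ := hx x
    exact hg' ((smul_mk_eq_iff x).1 hz g hg)

theorem fixedCard_cosets_self_ne_zero (K : Subgroup G) : (cosets K).fixedCard (K : Set G) ≠ 0 := by
  have : Nonempty {x : (cosets K).carrier // ∀ g ∈ (K : Set G), g • x = x} :=
    ⟨⟨((1 : G) : G ⧸ K), (smul_mk_eq_iff 1).2 (by simp)⟩⟩
  exact Nat.card_pos.ne'

theorem cosets_iso_of_fixedCard_ne_zero {K L : Subgroup G}
    (h : (cosets L).fixedCard (K : Set G) ≠ 0) (hc : Nat.card L ≤ Nat.card K) :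
    (cosets K).Iso (cosets L) := by
  obtain ⟨x, hx⟩ := exists_conj_mem_of_fixedCard_ne_zero h
  have hle : K.map (MulAut.conj x⁻¹).toMonoidHom ≤ L := by
    rintro _ ⟨k, hk, rfl⟩
    simpa using hx k hk
  have hL : K.map (MulAut.conj x⁻¹).toMonoidHom = L := by
    refine Subgroup.eq_of_le_of_card_ge hle (hc.trans_eq ?_)
    exact (Nat.card_congr (K.equivMapOfInjective _ (MulAut.conj x⁻¹).injective).toEquiv)
  have key (g : G) : g ∈ K ↔ x⁻¹ * g * x ∈ L := by
    refine ⟨hx g, fun hg => ?_⟩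
    rw [← hL] at hg
    obtain ⟨k, hk, hk'⟩ := hg
    obtain rfl : k = g := by simpa using hk'
    exact hk
  refine ⟨Quotient.congr (Equiv.mulRight x) fun a b => ?_, ?_⟩
  · rw [QuotientGroup.leftRel_apply, QuotientGroup.leftRel_apply, key]
    simp [mul_assoc]
  · rintro g ⟨y⟩
    exact congrArg (fun z : G => (z : G ⧸ L)) (mul_assoc g y x)

end FinGSet

/-- A combination of transitive `G`-sets `G/K` is zero if its marks at the stabilizers `K` vanish:
among the pairwise non-isomorphic `G/K` occurring in it, one with `|K|` maximal is the only one
with points fixed by `K`. -/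
theorem LocalBurnside.eq_zero_of_mark_eq_zero {p : ℕ} [Fact p.Prime] {G : Type u} [Group G]
    [Finite G] (𝒦 : Set (Subgroup G)) {ω : LocalBurnside p G}
    (hω : ω ∈ Submodule.span (ZLocal p) ((fun K => of (FinGSet.cosets K)) '' 𝒦))
    (h : ∀ K ∈ 𝒦, mark (K : Set G) ω = 0) : ω = 0 := by
  -- choose one subgroup for each class `[G/K]`
  obtain ⟨𝒦', h𝒦', hbij⟩ :=
    Set.exists_subset_bijOn 𝒦 (fun K => of (p := p) (FinGSet.cosets K))
  rw [← hbij.image_eq, Finsupp.mem_span_image_iff_linearCombination] at hω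
  obtain ⟨l, hl, rfl⟩ := hω
  rw [Finsupp.mem_supported] at hl
  by_contra hne
  have hsupp : l.support.Nonempty := by
    rw [Finsupp.support_nonempty_iff]
    rintro rfl
    simp at hne
  obtain ⟨K, hK, hmax⟩ := l.support.exists_max_image (fun K => Nat.card K) hsupp
  have hmark := h K (h𝒦' (hl hK))
  rw [Finsupp.linearCombination_apply, Finsupp.sum, map_sum, Finset.sum_eq_single K] at hmark
  · rw [map_smul, mark_of, smul_eq_mul, mul_eq_zero] at hmark
    rcases hmark with h0 | h0
    · exact Finsupp.mem_support_iff.1 hK h0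
    · exact FinGSet.fixedCard_cosets_self_ne_zero K (by exact_mod_cast h0)
  · intro L hL hLK
    rw [map_smul, mark_of]
    by_contra h0
    refine hLK (hbij.injOn (hl hL) (hl hK) ?_)
    have hiso := FinGSet.cosets_iso_of_fixedCard_ne_zero (K := K) (L := L)
      (fun h1 => h0 (by simp [h1])) (hmax L hL)
    exact congrArg (fun X => (1 : ZLocal p) ⊗ₜ[ℤ] Algebra.GrothendieckAddGroup.of X)
      (Quotient.sound hiso.symm : GSetClass.mk _ = GSetClass.mk _)
  · exact fun h' => (h' hK).elim

/-! ### Marks of stable, generated and idempotent virtual bisets -/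

namespace FusionSystem

variable {S : Type u} [Group S] {F : FusionSystem S} {p : ℕ} [Fact p.Prime]
  {ω : LocalBurnside p (S × S)}

theorem IsStable.mark_image (h : F.IsStable ω) {P Q : Subgroup S} {φ : P →* S} (hφ : φ ∈ F.Hom P)
    {ψ : Q →* S} (hψ : ψ ∈ F.Hom Q) (T : Set (P × Q)) :
    LocalBurnside.mark (φ.prodMap ψ '' T) ω =
      LocalBurnside.mark (P.subtype.prodMap Q.subtype '' T) ω := by
  rw [← LocalBurnside.mark_restrict, ← LocalBurnside.mark_restrict, h P Q φ hφ ψ hψ]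

/-- The mark of a virtual biset at the diagonal `Δ(P, id)`. -/
noncomputable def diagonalMark (ω : LocalBurnside p (S × S)) (P : Subgroup S) : ZLocal p :=
  LocalBurnside.mark (Set.range (P.subtype.prod P.subtype)) ω

theorem IsStable.mark_range_prod (h : F.IsStable ω) {P : Subgroup S} {φ ψ : P →* S}
    (hφ : φ ∈ F.Hom P) (hψ : ψ ∈ F.Hom P) :
    LocalBurnside.mark (Set.range (φ.prod ψ)) ω = diagonalMark ω P := by
  have (α β : P →* S) : Set.range (α.prod β) = α.prodMap β '' Set.range fun u : P => (u, u) := by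
    rw [← Set.range_comp]
    rfl
  rw [diagonalMark, this, this, h.mark_image hφ hψ]

variable [Finite S]

theorem rightFree_cosets_twistedDiagonal {P : Subgroup S} (φ : P →* S) :
    (FinGSet.cosets (twistedDiagonal φ)).RightFree := by
  intro s z hz
  induction z using Quotient.inductionOn' with
  | h x =>
    obtain ⟨u, hu⟩ := (FinGSet.smul_mk_eq_iff (T := {(1, s)}) x).1 (fun g hg => by rw [hg]; exact hz) _ rfl
    have h1 := congrArg Prod.fst hu
    have h2 := congrArg Prod.snd hu
    simp only [MonoidHom.prod_apply, Subgroup.subtype_apply, Prod.fst_mul, Prod.fst_inv, mul_one,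
      inv_mul_cancel, OneMemClass.coe_eq_one] at h1
    rw [h1] at h2
    have h3 : x.2⁻¹ * s * x.2 = 1 := by simpa [eq_comm] using h2
    simpa [mul_eq_one_iff_eq_inv] using h3

theorem IsGenerated.mem_span_rightFree (h : F.IsGenerated ω) :
    ω ∈ Submodule.span (ZLocal p)
      {x | ∃ X : FinGSet (S × S), X.RightFree ∧ x = LocalBurnside.of X} := by
  refine Submodule.span_mono ?_ h
  rintro _ ⟨P, φ, -, rfl⟩
  exact ⟨_, rightFree_cosets_twistedDiagonal φ, rfl⟩

/-- A set of pairs at which a generated virtual biset has nonzero mark is contained in the graph of a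
morphism of `F`, on any subgroup `P` of the subgroup generated by the first components. -/
theorem IsGenerated.exists_of_mark_ne_zero (h : F.IsGenerated ω) {T : Set (S × S)}
    (hT : LocalBurnside.mark T ω ≠ 0) (P : Subgroup S) (hP : P ≤ Subgroup.closure (Prod.fst '' T)) :
    ∃ φ ∈ F.Hom P, ∀ u : P, ∀ b, ((u : S), b) ∈ T → b = φ u := by
  contrapose! hT
  refine Submodule.span_induction (p := fun x _ => LocalBurnside.mark T x = 0) ?_ (map_zero _)
    (fun x y _ _ hx hy => by rw [map_add, hx, hy, add_zero])
    (fun c x _ hx => by rw [map_smul, hx, smul_zero]) h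
  rintro _ ⟨Q, ψ, hψ, rfl⟩
  rw [LocalBurnside.mark_of]
  by_contra h0
  obtain ⟨x, hx⟩ := FinGSet.exists_conj_mem_of_fixedCard_ne_zero
    (K := twistedDiagonal ψ) (T := T) (fun h1 => h0 (by simp [h1]))
  have hfst : Subgroup.closure (Prod.fst '' T) ≤ Q.comap (MulAut.conj x.1⁻¹).toMonoidHom := by
    rw [Subgroup.closure_le]
    rintro _ ⟨g, hg, rfl⟩
    obtain ⟨u, hu⟩ := hx g hg
    have h1 := congrArg Prod.fst hu
    simp only [MonoidHom.prod_apply, Subgroup.subtype_apply, Prod.fst_mul, Prod.fst_inv] at h1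
    simp [← h1]
  have hQ (u : P) : ((MulAut.conj x.1⁻¹).toMonoidHom.comp P.subtype) u ∈ Q := hfst (hP u.2)
  obtain ⟨u, b, hb, hne⟩ := hT _ (F.comp_mem (Q := ⊤) (fun _ => Subgroup.mem_top _)
    (F.comp_mem hQ (F.conj_mem P x.1⁻¹) hψ) (F.conj_mem ⊤ x.2))
  obtain ⟨v, hv⟩ := hx _ hb
  have h1 := congrArg Prod.fst hv
  have h2 := congrArg Prod.snd hv
  simp only [MonoidHom.prod_apply, Subgroup.subtype_apply, Prod.fst_mul, Prod.fst_inv,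
    Prod.snd_mul, Prod.snd_inv] at h1 h2
  have hv' : ((MulAut.conj x.1⁻¹).toMonoidHom.comp P.subtype).codRestrict Q hQ u = v :=
    Subtype.ext (by simp [h1])
  refine hne ?_
  rw [show b = x.2 * ψ v * x.2⁻¹ by rw [h2]; group, ← hv']
  rfl

theorem IsGenerated.mark_range_prod_eq_zero (h : F.IsGenerated ω) {P : Subgroup S} {φ : P →* S}
    (hφ : φ ∉ F.Hom P) : LocalBurnside.mark (Set.range (P.subtype.prod φ)) ω = 0 := by
  by_contra h0
  obtain ⟨ψ, hψ, h1⟩ := h.exists_of_mark_ne_zero h0 P fun u hu =>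
    Subgroup.subset_closure ⟨(u, φ ⟨u, hu⟩), ⟨⟨u, hu⟩, rfl⟩, rfl⟩
  obtain rfl : φ = ψ := MonoidHom.ext fun u => h1 u _ ⟨u, rfl⟩
  exact hφ hψ

theorem mark_range_prod_eq_ite (hs : F.IsStable ω) (hg : F.IsGenerated ω) {P : Subgroup S}
    (φ : P →* S) [Decidable (φ ∈ F.Hom P)] :
    LocalBurnside.mark (Set.range (P.subtype.prod φ)) ω =
      if φ ∈ F.Hom P then diagonalMark ω P else 0 := by
  split_ifs with hφ
  · exact hs.mark_range_prod (F.subtype_mem P) hφ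
  · exact hg.mark_range_prod_eq_zero hφ

/-- The linearized number of points of `ω/S` fixed by `P`. The set `X/S` is encoded as the
composite of `X` with the one-point biset. -/
noncomputable def quotientMark (ω : LocalBurnside p (S × S)) (P : Subgroup S) : ZLocal p :=
  LocalBurnside.mark (Set.range (P.subtype.prod (1 : P →* S)))
    (LocalBurnside.comp ω (LocalBurnside.of (FinGSet.point (S × S))))

theorem card_mul_quotientMark (hs : F.IsStable ω) (hg : F.IsGenerated ω) (P : Subgroup S) :
    (Nat.card S : ZLocal p) * quotientMark ω P =
      (Nat.card (F.Hom P) : ZLocal p) * diagonalMark ω P := by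
  classical
  have : Finite (P →* S) := DFunLike.finite _
  have : Fintype (P →* S) := Fintype.ofFinite _
  rw [quotientMark, LocalBurnside.card_mul_mark_comp hg.mem_span_rightFree]
  simp only [mark_range_prod_eq_ite hs hg, LocalBurnside.mark_of, FinGSet.fixedCard_point,
    Nat.cast_one, mul_one, ← Finset.sum_filter, Finset.sum_const, nsmul_eq_mul]
  rw [Nat.card_eq_fintype_card, Fintype.card_subtype]

theorem IsCharacteristicIdempotent.card_mul_diagonalMark (h : F.IsCharacteristicIdempotent ω)
    (P : Subgroup S) :
    (Nat.card S : ZLocal p) * diagonalMark ω P =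
      (Nat.card (F.Hom P) : ZLocal p) * (diagonalMark ω P * diagonalMark ω P) := by
  classical
  have : Finite (P →* S) := DFunLike.finite _
  have : Fintype (P →* S) := Fintype.ofFinite _
  conv_lhs => rw [diagonalMark, ← h.idempotent,
    LocalBurnside.card_mul_mark_comp h.generated.mem_span_rightFree]
  have key (φ : P →* S) : LocalBurnside.mark (Set.range (P.subtype.prod φ)) ω *
      LocalBurnside.mark (Set.range (φ.prod P.subtype)) ω =
      if φ ∈ F.Hom P then diagonalMark ω P * diagonalMark ω P else 0 := by
    rw [mark_range_prod_eq_ite h.stable h.generated]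
    split_ifs with hφ
    · rw [h.stable.mark_range_prod hφ (F.subtype_mem P)]
    · rw [zero_mul]
  simp only [key, ← Finset.sum_filter, Finset.sum_const, nsmul_eq_mul]
  rw [Nat.card_eq_fintype_card, Fintype.card_subtype]

theorem natCard_group_ne_zero : (Nat.card S : ZLocal p) ≠ 0 :=
  Nat.cast_ne_zero.2 Nat.card_pos.ne'

theorem natCard_hom_ne_zero (P : Subgroup S) : (Nat.card (F.Hom P) : ZLocal p) ≠ 0 := by
  have : Finite (P →* S) := DFunLike.finite _
  have : Nonempty (F.Hom P) := ⟨⟨_, F.subtype_mem P⟩⟩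
  exact Nat.cast_ne_zero.2 Nat.card_pos.ne'

theorem IsCharacteristicIdempotent.quotientMark_mul_self (h : F.IsCharacteristicIdempotent ω)
    (P : Subgroup S) : quotientMark ω P * quotientMark ω P = quotientMark ω P := by
  have h1 := card_mul_quotientMark h.stable h.generated P
  have h2 := h.card_mul_diagonalMark P
  have h0 := natCard_group_ne_zero (S := S) (p := p)
  refine mul_left_cancel₀ h0 (mul_left_cancel₀ h0 ?_)
  linear_combination (Nat.card S * quotientMark ω P + Nat.card (F.Hom P) * diagonalMark ω P -
    Nat.card S : ZLocal p) * h1 - (Nat.card (F.Hom P) : ZLocal p) * h2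

theorem natCast_prime_not_dvd_one : ¬ (p : ZLocal p) ∣ 1 := by
  rintro ⟨z, hz⟩
  have hp : p.Prime := Fact.out
  have h : (z : ℚ) = (p : ℚ)⁻¹ := by
    have := congrArg (Subtype.val) hz
    exact eq_inv_of_mul_eq_one_right (by simpa using this.symm)
  have hz' : ¬ p ∣ (z : ℚ).den := z.2
  rw [h, Rat.inv_natCast_den_of_pos hp.pos] at hz'
  exact hz' dvd_rfl

/-- The marks of `ω/S` are idempotents which are all congruent modulo `p`, hence all equal; they do
not all vanish since `ω ≠ 0`. -/
theorem IsCharacteristicIdempotent.quotientMark_ne_zero (hS : IsPGroup p S)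
    (h : F.IsCharacteristicIdempotent ω) (P : Subgroup S) : quotientMark ω P ≠ 0 := by
  intro hP
  have hall (Q : Subgroup S) : quotientMark ω Q = 0 := by
    have hidem := h.quotientMark_mul_self Q
    have hdvd := dvd_sub
      (LocalBurnside.dvd_mark_range_sub_mark_empty (hS.to_subgroup Q) (Q.subtype.prod (1 : Q →* S))
        (LocalBurnside.comp ω (LocalBurnside.of (FinGSet.point (S × S)))))
      (LocalBurnside.dvd_mark_range_sub_mark_empty (hS.to_subgroup P) (P.subtype.prod (1 : P →* S))
        (LocalBurnside.comp ω (LocalBurnside.of (FinGSet.point (S × S)))))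
    rw [sub_sub_sub_cancel_right] at hdvd
    change (p : ZLocal p) ∣ quotientMark ω Q - quotientMark ω P at hdvd
    rw [hP, sub_zero] at hdvd
    by_contra hQ
    rw [mul_left_cancel₀ hQ (hidem.trans (mul_one _).symm)] at hdvd
    exact natCast_prime_not_dvd_one hdvd
  refine h.ne_zero (LocalBurnside.eq_zero_of_mark_eq_zero
    {K | ∃ Q : Subgroup S, ∃ φ ∈ F.Hom Q, K = twistedDiagonal φ}
    (Submodule.span_mono ?_ h.generated) ?_)
  · rintro _ ⟨Q, φ, hφ, rfl⟩
    exact ⟨_, ⟨Q, φ, hφ, rfl⟩, rfl⟩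
  · rintro _ ⟨Q, φ, hφ, rfl⟩
    rw [twistedDiagonal, MonoidHom.coe_range, h.stable.mark_range_prod (F.subtype_mem Q) hφ]
    have h1 := card_mul_quotientMark h.stable h.generated Q
    rw [hall, mul_zero] at h1
    exact (mul_eq_zero.1 h1.symm).resolve_left (natCard_hom_ne_zero Q)

/-- The marks of the characteristic idempotent at the diagonals do not vanish. -/
theorem IsCharacteristicIdempotent.diagonalMark_ne_zero (hS : IsPGroup p S)
    (h : F.IsCharacteristicIdempotent ω) (P : Subgroup S) : diagonalMark ω P ≠ 0 := by
  intro h0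
  have h1 := card_mul_quotientMark h.stable h.generated P
  rw [h0, mul_zero] at h1
  exact h.quotientMark_ne_zero hS P ((mul_eq_zero.1 h1).resolve_left natCard_group_ne_zero)

end FusionSystem

/-! ### Marks at cyclic subgroups and double orbits -/

theorem LocalBurnside.mark_eq_of_closure_eq {p : ℕ} [Fact p.Prime] {G : Type u} [Group G]
    {T T' : Set G} (h : Subgroup.closure T = Subgroup.closure T') :
    mark (p := p) T = mark T' := by
  refine hom_ext fun X => ?_
  have key (T : Set G) (x : X.carrier) :
      (∀ g ∈ T, g • x = x) ↔ Subgroup.closure T ≤ MulAction.stabilizer G x := by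
    rw [Subgroup.closure_le]
    rfl
  rw [mark_of, mark_of]
  exact congrArg _ (Nat.card_congr (Equiv.subtypeEquivRight fun x => by rw [key, key, h]))

/-- Elements generating the same subgroup of a `p`-group are powers of each other with exponent
prime to the order of the group. -/
theorem IsPGroup.exists_pow_eq_of_zpowers_eq {p : ℕ} [Fact p.Prime] {S : Type*} [Group S] [Finite S]
    (hS : IsPGroup p S) {a b : S} (h : Subgroup.zpowers a = Subgroup.zpowers b) :
    ∃ k : ℕ, (Nat.card S).Coprime k ∧ a ^ k = b := by
  by_cases ha : a = 1
  · subst ha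
    rw [Subgroup.zpowers_one_eq_bot, eq_comm, Subgroup.zpowers_eq_bot] at h
    exact ⟨1, Nat.coprime_one_right _, by simp [h]⟩
  obtain ⟨k, rfl⟩ := mem_powers_iff_mem_zpowers.2 (h ▸ Subgroup.mem_zpowers b : b ∈ Subgroup.zpowers a)
  refine ⟨k, ?_, rfl⟩
  have hord : orderOf (a ^ k) = orderOf a := by
    rw [← Nat.card_zpowers, ← Nat.card_zpowers]
    exact congrArg (fun H : Subgroup S => Nat.card H) h.symm
  have hcop : (orderOf a).Coprime k := by
    rw [orderOf_pow] at hord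
    exact (Nat.div_eq_self.1 hord).resolve_left (orderOf_pos a).ne'
  obtain ⟨n, hn⟩ := (IsPGroup.iff_orderOf.1 hS) a
  obtain ⟨m, hm⟩ := IsPGroup.iff_card.1 hS
  have hn0 : n ≠ 0 := by
    rintro rfl
    exact ha (orderOf_eq_one_iff.1 (by simpa using hn))
  rw [hn] at hcop
  rw [hm]
  exact ((Nat.coprime_pow_left_iff (Nat.pos_of_ne_zero hn0) _ _).1 hcop).pow_left m

namespace FusionSystem

open LocalBurnside

variable {S : Type u} [Group S] {F : FusionSystem S} {p : ℕ} [Fact p.Prime]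
  {ω : LocalBurnside p (S × S)}

theorem IsStable.mark_apply_pair (h : F.IsStable ω) {P Q : Subgroup S} {φ : P →* S}
    (hφ : φ ∈ F.Hom P) {ψ : Q →* S} (hψ : ψ ∈ F.Hom Q) (a : P) (b : Q) :
    mark {(φ a, ψ b)} ω = mark {((a : S), (b : S))} ω := by
  simpa using h.mark_image hφ hψ {(a, b)}

theorem mark_pair_self (ω : LocalBurnside p (S × S)) (a : S) :
    mark {(a, a)} ω = diagonalMark ω (Subgroup.zpowers a) := by
  rw [diagonalMark]
  congr 1
  apply mark_eq_of_closure_eq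
  apply le_antisymm
  · rw [Subgroup.closure_le, Set.singleton_subset_iff]
    exact Subgroup.subset_closure ⟨⟨a, Subgroup.mem_zpowers a⟩, rfl⟩
  · rw [Subgroup.closure_le, ← Subgroup.zpowers_eq_closure]
    rintro _ ⟨⟨_, k, rfl⟩, rfl⟩
    exact ⟨k, rfl⟩

/-- The sum of the marks of `ω` at the pairs `(a, b)` with `b ∈ Q`. -/
noncomputable def markSum (ω : LocalBurnside p (S × S)) (a : S) (Q : Subgroup S) : ZLocal p :=
  ∑ᶠ b : Q, mark {(a, (b : S))} ω

variable [Finite S]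

theorem IsGenerated.exists_of_mark_pair_ne_zero (h : F.IsGenerated ω) {a b : S}
    (hab : mark {(a, b)} ω ≠ 0) :
    ∃ φ ∈ F.Hom (Subgroup.zpowers a), b = φ ⟨a, Subgroup.mem_zpowers a⟩ := by
  obtain ⟨φ, hφ, h1⟩ := h.exists_of_mark_ne_zero hab (Subgroup.zpowers a)
    (by rw [Set.image_singleton, Subgroup.zpowers_eq_closure])
  exact ⟨φ, hφ, h1 ⟨a, Subgroup.mem_zpowers a⟩ b rfl⟩

omit [Finite S] in
theorem range_eq_zpowers {a : S} (φ : Subgroup.zpowers a →* S) :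
    φ.range = Subgroup.zpowers (φ ⟨a, Subgroup.mem_zpowers a⟩) := by
  ext x
  constructor
  · rintro ⟨⟨_, k, rfl⟩, rfl⟩
    exact ⟨k, (map_zpow φ _ k).symm⟩
  · rintro ⟨k, rfl⟩
    exact ⟨⟨a, Subgroup.mem_zpowers a⟩ ^ k, map_zpow φ _ k⟩

/-- The pairs `(a, b)` and `(aᵏ, bᵏ)` generate the same subgroup if `k` is prime to `|S|`, so the
sum depends only on the `F`-conjugacy class of the subgroup generated by `a`. -/
theorem IsStable.markSum_congr (hS : IsPGroup p S) (h : F.IsStable ω) {a a' : S}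
    (ha : F.IsConj (Subgroup.zpowers a) (Subgroup.zpowers a')) (Q : Subgroup S) :
    markSum ω a Q = markSum ω a' Q := by
  obtain ⟨φ, hφ, hr⟩ := ha
  rw [range_eq_zpowers] at hr
  set b := φ ⟨a, Subgroup.mem_zpowers a⟩ with hb
  obtain ⟨k, hk, rfl⟩ := hS.exists_pow_eq_of_zpowers_eq hr
  have hkQ : (Nat.card Q).Coprime k := hk.coprime_dvd_left Q.card_subgroup_dvd_card
  have h1 : markSum ω a Q = markSum ω b Q :=
    finsum_congr fun c => (h.mark_apply_pair hφ (F.subtype_mem Q) ⟨a, Subgroup.mem_zpowers a⟩ c).symm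
  refine h1.trans (Eq.trans (finsum_congr fun c => ?_)
    (finsum_comp_equiv (f := fun c : Q => mark {(b ^ k, (c : S))} ω) (powCoprime hkQ)))
  congr 1
  apply mark_eq_of_closure_eq
  rw [← Subgroup.zpowers_eq_closure, ← Subgroup.zpowers_eq_closure]
  have hpow : (b ^ k, ((powCoprime hkQ c : Q) : S)) = (b, (c : S)) ^ k := rfl
  rw [hpow]
  apply le_antisymm
  · have hcop : k.Coprime (orderOf (b, (c : S))) := by
      have : orderOf (b, (c : S)) ∣ Nat.card S * Nat.card S := by
        rw [← Nat.card_prod]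
        exact orderOf_dvd_natCard _
      exact ((hk.mul_left hk).coprime_dvd_left this).symm
    obtain ⟨m, hm⟩ := exists_pow_eq_self_of_coprime hcop
    rw [Subgroup.zpowers_le]
    exact ⟨m, by simpa using hm⟩
  · rw [Subgroup.zpowers_le]
    exact ⟨k, by simp⟩

theorem IsGenerated.exists_isConj_of_markSum_ne_zero (h : F.IsGenerated ω) {a : S} {Q : Subgroup S}
    (ha : markSum ω a Q ≠ 0) : ∃ b ∈ Q, F.IsConj (Subgroup.zpowers a) (Subgroup.zpowers b) := by
  obtain ⟨b, hb⟩ : ∃ b : Q, mark {(a, (b : S))} ω ≠ 0 := by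
    by_contra! h0
    exact ha (finsum_eq_zero_of_forall_eq_zero h0)
  obtain ⟨φ, hφ, h1⟩ := h.exists_of_mark_pair_ne_zero hb
  exact ⟨b, b.2, φ, hφ, by rw [range_eq_zpowers, h1]⟩

theorem IsCharacteristicIdempotent.markSum_self_ne_zero (hS : IsPGroup p S)
    (h : F.IsCharacteristicIdempotent ω) (a : S) : markSum ω a (Subgroup.zpowers a) ≠ 0 := by
  classical
  have : Fintype (Subgroup.zpowers a) := Fintype.ofFinite _
  have hc := h.diagonalMark_ne_zero hS (Subgroup.zpowers a)
  -- each summand is zero or the mark at `(a, a)`, and the latter value is taken at `b = a`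
  have key (b : Subgroup.zpowers a) : mark {(a, (b : S))} ω =
      if mark {(a, (b : S))} ω ≠ 0 then diagonalMark ω (Subgroup.zpowers a) else 0 := by
    split_ifs with hb
    · obtain ⟨φ, hφ, h1⟩ := h.generated.exists_of_mark_pair_ne_zero hb
      rw [h1, ← mark_pair_self]
      exact h.stable.mark_apply_pair (F.subtype_mem _) hφ ⟨a, Subgroup.mem_zpowers a⟩
        ⟨a, Subgroup.mem_zpowers a⟩
    · exact not_not.1 hb
  rw [markSum, finsum_eq_sum_of_fintype, Finset.sum_congr rfl fun b _ => key b,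
    ← Finset.sum_filter, Finset.sum_const, nsmul_eq_mul]
  refine mul_ne_zero (Nat.cast_ne_zero.2 (Finset.card_ne_zero_of_mem
    (a := ⟨a, Subgroup.mem_zpowers a⟩) ?_)) hc
  simpa [mark_pair_self] using hc

theorem card_mul_doubleOrbitCount (ω : LocalBurnside p (S × S)) (P Q : Subgroup S) :
    (Nat.card P : ZLocal p) * Nat.card Q * doubleOrbitCount ω P Q = ∑ᶠ a : P, markSum ω a Q := by
  have : Fintype P := Fintype.ofFinite _
  have : Fintype Q := Fintype.ofFinite _
  rw [doubleOrbitCount, ← Nat.cast_mul, ← Nat.card_prod, card_mul_orbitCount,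
    Fintype.sum_prod_type, finsum_eq_sum_of_fintype]
  refine Finset.sum_congr rfl fun a _ => ?_
  rw [markSum, finsum_eq_sum_of_fintype]
  refine Finset.sum_congr rfl fun b _ => ?_
  rw [mark_restrict, Set.image_singleton]
  rfl

variable {P Q : Subgroup S}

omit [Finite S] in
theorem IsConj.card_eq (h : F.IsConj P Q) : Nat.card P = Nat.card Q := by
  obtain ⟨φ, hφ, rfl⟩ := h
  exact Nat.card_congr (φ.ofInjective (F.injective hφ)).toEquiv

omit [Finite S] in
theorem IsConj.isCyclic (h : F.IsConj P Q) [IsCyclic P] : IsCyclic Q := by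
  obtain ⟨φ, hφ, rfl⟩ := h
  exact isCyclic_of_surjective φ.rangeRestrict φ.rangeRestrict_surjective

end FusionSystem

/-! ### The rank of the matrix of double orbit numbers -/

namespace Matrix

variable {K ι κ : Type*} [Field K] [Fintype ι] [Fintype κ] [DecidableEq κ]

/-- A matrix which is triangular with respect to a strict ordering of the indices and has nonzero
diagonal entries is invertible. -/
theorem isUnit_of_triangular {α : Type*} [LinearOrder α] (T : Matrix κ κ K) (d : κ → α)
    (hdiag : ∀ i, T i i ≠ 0) (htri : ∀ i j, i ≠ j → T i j ≠ 0 → d i < d j) : IsUnit T := by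
  classical
  rw [← mulVec_injective_iff_isUnit]
  refine (injective_iff_map_eq_zero T.mulVecLin).2 ?_
  intro v hv
  by_contra hne
  obtain ⟨i₀, hi₀⟩ := Function.ne_iff.1 hne
  obtain ⟨i, hi, hmax⟩ := ({i | v i ≠ 0} : Finset κ).exists_max_image d ⟨i₀, by simpa using hi₀⟩
  have h := congrFun hv i
  rw [mulVecLin_apply, mulVec, dotProduct, Finset.sum_eq_single i] at h
  · exact (mul_ne_zero (hdiag i) (by simpa using hi)) h
  · intro j _ hj
    by_contra h0
    exact (hmax j (by simpa using right_ne_zero_of_mul h0)).not_gt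
      (htri i j hj.symm (left_ne_zero_of_mul h0))
  · simp

theorem rank_mul_eq_card (B : Matrix ι κ K) (N : Matrix κ ι K) (e : κ → ι)
    (hB : IsUnit (B.submatrix e id)) (hN : IsUnit (N.submatrix id e)) :
    (B * N).rank = Fintype.card κ := by
  refine le_antisymm ((rank_mul_le_left B N).trans B.rank_le_card_width) ?_
  rw [← rank_of_isUnit _ (hB.mul hN)]
  rw [← submatrix_mul B N e id e Function.bijective_id]
  exact rank_submatrix_le _ _ _

end Matrix

theorem theorem1p4 {p : ℕ} [Fact p.Prime] {S : Type u} [Group S] [Finite S] (hS : IsPGroup p S)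
    (F : FusionSystem S) (hF : F.IsSaturated p)
    (ω : LocalBurnside p (S × S)) (hω : F.IsCharacteristicIdempotent ω)
    (rep : F.SubgroupClass → Subgroup S) (hrep : ∀ c, F.classOf (rep c) = c) :
    (Matrix.of fun c d : F.SubgroupClass =>
        (LocalBurnside.doubleOrbitCount ω (rep c) (rep d) : ℚ)).rank =
      Nat.card F.cyclicClasses := by
  classical
  have hcyc (K : F.cyclicClasses) : ∃ x : S, Subgroup.zpowers x = rep K := by
    obtain ⟨P, hP, hPK⟩ := K.2
    have hconj : F.IsConj P (rep K) := Quotient.exact (hPK.trans (hrep K).symm)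
    exact Subgroup.isCyclic_iff_exists_zpowers_eq_top (rep K) |>.1 hconj.isCyclic
  choose x hx using hcyc
  have hclass (a : S) : F.classOf (Subgroup.zpowers a) ∈ F.cyclicClasses := ⟨_, inferInstance, rfl⟩
  have hxclass (K : F.cyclicClasses) : F.classOf (Subgroup.zpowers (x K)) = K := by rw [hx, hrep]
  let κ (a : S) : F.cyclicClasses := ⟨_, hclass a⟩
  have : Fintype F.cyclicClasses := Fintype.ofFinite _
  have (P : Subgroup S) : Fintype P := Fintype.ofFinite _
  have hcard (P : Subgroup S) : (Nat.card P : ℚ) ≠ 0 := Nat.cast_ne_zero.2 Nat.card_pos.ne'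
  -- the proportion of elements of `rep c` generating a cyclic subgroup in the class `K`
  let B : Matrix F.SubgroupClass F.cyclicClasses ℚ := Matrix.of fun c K =>
    (Finset.card {a : rep c | κ a = K} : ℚ) / Nat.card (rep c)
  let N : Matrix F.cyclicClasses F.SubgroupClass ℚ := Matrix.of fun K d =>
    (FusionSystem.markSum ω (x K) (rep d) : ℚ) / Nat.card (rep d)
  have hfactor : (Matrix.of fun c d : F.SubgroupClass =>
      (LocalBurnside.doubleOrbitCount ω (rep c) (rep d) : ℚ)) = B * N := by
    ext c d
    have h := FusionSystem.card_mul_doubleOrbitCount ω (rep c) (rep d)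
    have hsum : ∑ᶠ a : rep c, FusionSystem.markSum ω (a : S) (rep d) =
        ∑ K, (Finset.card {a : rep c | κ a = K} : ZLocal p) *
          FusionSystem.markSum ω (x K) (rep d) := by
      rw [finsum_eq_sum_of_fintype, ← Finset.sum_fiberwise _ (fun a : rep c => κ a)]
      refine Finset.sum_congr rfl fun K _ => ?_
      rw [← nsmul_eq_mul]
      refine Finset.sum_eq_card_nsmul fun a ha => ?_
      have hconj : F.IsConj (Subgroup.zpowers (a : S)) (Subgroup.zpowers (x K)) := Quotient.exact
        ((congrArg Subtype.val (Finset.mem_filter.1 ha).2).trans (hxclass K).symm)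
      exact hω.stable.markSum_congr hS hconj _
    have h' := congrArg (ZLocal p).subtype (h.trans hsum)
    simp only [map_mul, map_sum, map_natCast, Subring.subtype_apply] at h'
    have hc := hcard (rep c)
    have hd := hcard (rep d)
    rw [Matrix.mul_apply, Matrix.of_apply]
    refine mul_left_cancel₀ (mul_ne_zero hc hd) (h'.trans ?_)
    rw [Finset.mul_sum]
    refine Finset.sum_congr rfl fun K _ => ?_
    simp only [B, N, Matrix.of_apply]
    field_simp
  -- an element of `rep L` generating a subgroup in a class `K ≠ L` forces `|rep K| < |rep L|`, which
  -- makes the square blocks of `B` and `N` triangular in opposite senses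
  have hle {K L : F.cyclicClasses} {b : S} (hb : b ∈ rep L)
      (hbK : F.classOf (Subgroup.zpowers b) = K) (hne : K ≠ L) :
      Nat.card (rep K) < Nat.card (rep L) := by
    have hconj : F.IsConj (Subgroup.zpowers b) (rep K) := Quotient.exact (hbK.trans (hrep K).symm)
    have hsub : Subgroup.zpowers b ≤ rep L := by rwa [Subgroup.zpowers_le]
    rw [← hconj.card_eq]
    refine lt_of_not_ge fun hge => hne (Subtype.ext ?_)
    rw [← hbK, Subgroup.eq_of_le_of_card_ge hsub hge, hrep]
  rw [hfactor, Matrix.rank_mul_eq_card B N Subtype.val, Nat.card_eq_fintype_card]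
  · refine Matrix.isUnit_of_triangular _
      (fun K => OrderDual.toDual (Nat.card (rep K))) (fun K => ?_) fun L K hne hLK => ?_
    · refine div_ne_zero (Nat.cast_ne_zero.2 (Finset.card_ne_zero_of_mem
        (a := ⟨x K, hx K ▸ Subgroup.mem_zpowers (x K)⟩) ?_)) (hcard _)
      exact Finset.mem_filter.2 ⟨Finset.mem_univ _, Subtype.ext (hxclass K)⟩
    · have h0 := left_ne_zero_of_mul hLK
      obtain ⟨a, ha⟩ := Finset.card_ne_zero.1 (Nat.cast_ne_zero.1 h0)
      exact hle a.2 (congrArg Subtype.val (Finset.mem_filter.1 ha).2) hne.symm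
  · refine Matrix.isUnit_of_triangular _ (fun K => Nat.card (rep K)) (fun K => ?_)
      fun K L hne hKL => ?_
    · refine div_ne_zero ?_ (hcard _)
      have h0 := hω.markSum_self_ne_zero hS (x K)
      rw [hx] at h0
      exact Subtype.coe_ne_coe.2 h0
    · have h0 : FusionSystem.markSum ω (x K) (rep L) ≠ 0 := fun h0 => hKL (by simp [N, h0])
      obtain ⟨b, hb, hconj⟩ := hω.generated.exists_isConj_of_markSum_ne_zero h0
      exact hle hb ((Quotient.sound hconj).symm.trans (hxclass K)) hne
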